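/- Let $r\ge 2$, $1\le i\le r$ and $m\ge 0$ be integers. For $n\ge 0$ let $b_{r,i}(m,n)$ be the number of partitions $\lambda_1\ge\lambda_2\ge\cdots\ge\lambda_m\ge 1$ of $n$ with exactly $m$ parts such that $\lambda_j-\lambda_{j+r-1}\ge 2$ for all $j$ with $1\le j\le m-r+1$ and at most $i-1$ of the parts are equal to $1$ (the empty partition is the only partition of $0$). Put $(q)_0=1$ and $(q)_k=(1-q)(1-q^2)\cdots(1-q^k)$ for $k\ge 1$. Then, as formal power series in $q$, $$\sum_{n\ge 0} b_{r,i}(m,n)\,q^n=\sum_{\substack{\partial_1\ge\cdots\ge\partial_{r-1}\ge 0\\ \partial_1+\cdots+\partial_{r-1}=m+r-i}}\frac{q^{\partial_1^2+\cdots+\partial_{r-1}^2-\partial_1-\cdots-\partial_{r-i}}\,(1-q^{\partial_{r-i}})}{(q)_{\partial_1-\partial_2}\cdots(q)_{\partial_{r-2}-\partial_{r-1}}\,(q)_{\partial_{r-1}}},$$ where the sum is over integer sequences $(\partial_1,\dots,\partial_{r-1})$, and where for $i=r$ the terms $-\partial_1-\cdots-\partial_{r-i}$ are absent from the exponent and the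 factor $1-q^{\partial_{r-i}}$ is replaced by $1$. -/

import Mathlib

open PowerSeries

/-- The parts of a partition in non-increasing order, `λ₁ ≥ λ₂ ≥ ⋯ ≥ λₛ`
(as a list, so `λ_{j+1}` is the entry of index `j`). -/
def partsList {n : ℕ} (p : n.Partition) : List ℕ :=
  p.parts.sort (· ≥ ·)

/-- The set `𝓑_{r,i}(n)`: partitions `(λ₁, …, λₛ)` of `n` with `λ_j - λ_{j+r-1} ≥ 2` whenever
both parts exist, and with at most `i - 1` parts equal to `1`. The difference is written
additively, and indices start at `0`. -/
def gordonSet (r i n : ℕ) : Set n.Partition :=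
  {p | (∀ (j : ℕ) (h : j + (r - 1) < (partsList p).length),
          (partsList p)[j + (r - 1)] + 2 ≤ (partsList p)[j]) ∧
       p.parts.count 1 ≤ i - 1}

/-- `b_{r,i}(m,n)`: the number of partitions in `𝓑_{r,i}(n)` with exactly `m` parts. -/
noncomputable def gordonCount (r i m n : ℕ) : ℕ :=
  {p : n.Partition | p ∈ gordonSet r i n ∧ p.parts.card = m}.ncard

/-- `(q)_k = (1 - q)(1 - q²)⋯(1 - q^k)`, with `(q)_0 = 1`, as a formal power series. -/
noncomputable def qFactorial (k : ℕ) : ℚ⟦X⟧ :=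
  ∏ j ∈ Finset.Icc 1 k, (1 - X ^ j)

/-- The finite set of sequences `∂₁ ≥ ⋯ ≥ ∂_{r-1} ≥ 0` of natural numbers with
`∂₁ + ⋯ + ∂_{r-1} = N`. A sequence is stored as a function `d : ℕ → ℕ` with `d j = ∂_j` for
`1 ≤ j ≤ r - 1` and `d j = 0` for every other `j`; in particular `d r = 0`. -/
def durfeeSides (r N : ℕ) : Finset (ℕ → ℕ) :=
  {d ∈ Finset.piAntidiag (Finset.Icc 1 (r - 1)) N | ∀ j ∈ Finset.Ico 1 (r - 1), d (j + 1) ≤ d j}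

/-- The factor `1 - q^{∂_{r-i}}`, which is read as `1` (that is, `q^{∂_0} = 0`) when `i = r`. -/
noncomputable def lastFactor (r i : ℕ) (d : ℕ → ℕ) : ℚ⟦X⟧ :=
  if i = r then 1 else 1 - X ^ d (r - i)

/-- The summand
`q^{∂₁² + ⋯ + ∂_{r-1}² - ∂₁ - ⋯ - ∂_{r-i}} (1 - q^{∂_{r-i}})
  / ((q)_{∂₁-∂₂} ⋯ (q)_{∂_{r-2}-∂_{r-1}} (q)_{∂_{r-1}})`.
The subtraction in the exponent does not truncate for `i ≥ 1`, since `∂_j ≤ ∂_j²`. The factor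
`j = r - 1` of the denominator is `(q)_{∂_{r-1}}` because `d r = 0`. Each `(q)_k` has constant
coefficient `1`, so `⁻¹` is a true inverse. -/
noncomputable def gordonSummand (r i : ℕ) (d : ℕ → ℕ) : ℚ⟦X⟧ :=
  X ^ (∑ j ∈ Finset.Icc 1 (r - 1), d j ^ 2 - ∑ j ∈ Finset.Icc 1 (r - i), d j) *
    lastFactor r i d *
    (∏ j ∈ Finset.Icc 1 (r - 1), qFactorial (d j - d (j + 1)))⁻¹

/-! Write k = r - 1 and c = i - 1. Both sides satisfy one recurrence in (c, m), which has a single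
solution.

Partitions: the difference condition says that any two consecutive integers account for at most k
parts (`forall_getElem_add_two_le_iff`). If 1 occurs exactly c times, lowering all m parts by 1 and
dropping the zeros leaves m - c parts, with at most k - c ones. So the generating functions B_c(m)
satisfy B_0(m) = q^m B_k(m) and B_{c+1}(m) - B_c(m) = q^m B_{k-c-1}(m-c-1), the last term being 0
for m < c + 1.

Series: let S_j(N) be the sum of q^{∂₁²+⋯+∂_k² - ∂₁-⋯-∂_j} / ((q)_{∂₁-∂₂} ⋯ (q)_{∂_k}) over
sequences of sum N. Clearly S_0(N) = q^N S_k(N). The key identity, `sideSum_succ_sub`, is S_{j+1}(N)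
- S_j(N) = q^{N-j-1} S_{k-j-1}(N-j-1), proved by induction on k after splitting off the smallest
entry ∂_k. It is used twice. It shows that q^m S_c(m) obeys the recurrence of B_c(m). It also
evaluates the right side of the theorem: for i < r the factor 1 - q^{∂_{r-i}} makes that side
S_{k-c}(N) - S_{k-c-1}(N) with N = m + k - c, which is q^m S_c(m); for i = r it is S_0(m) = q^m
S_k(m). -/

/-! ### The q-difference identity for the sums S_j(N), over a field -/

/-- The finite product `(1 - q)(1 - q²)⋯(1 - q^n)` in a field. -/
def qPoch {L : Type*} [Field L] (q : L) (n : ℕ) : L :=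
  ∏ j ∈ Finset.Icc 1 n, (1 - q ^ j)

/-- The coefficient of `x^N` in
`∑ x^{∂₁+⋯+∂_k} q^{∂₁²+⋯+∂_k² - ∂₁-⋯-∂_j} / ((q)_{∂₁-∂₂} ⋯ (q)_{∂_k})`, computed by
splitting off the smallest entry `∂_k = n`. -/
def sideSum {L : Type*} [Field L] (q : L) : ℕ → ℕ → ℤ → L
  | 0, _, N => if N = 0 then 1 else 0
  | k + 1, j, N => ∑ n ∈ Finset.range (N.toNat + 1),
      q ^ ((k + 1) * n ^ 2 - j * n + 2 * n * (N - (k + 1) * n) : ℤ) / qPoch q n *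
        sideSum q k (min j k) (N - (k + 1) * n)

section SideSum

variable {L : Type*} [Field L] {q : L}

theorem qPoch_succ (n : ℕ) : qPoch q (n + 1) = qPoch q n * (1 - q ^ (n + 1)) := by
  unfold qPoch
  rw [Finset.prod_Icc_succ_top (by omega)]

theorem sideSum_of_neg (k j : ℕ) {N : ℤ} (hN : N < 0) : sideSum q k j N = 0 := by
  induction k generalizing j N with
  | zero => simp [sideSum, hN.ne]
  | succ k ih =>
    rw [sideSum]
    refine Finset.sum_eq_zero fun n _ => ?_
    rw [ih, mul_zero]
    nlinarith [Int.natCast_nonneg n, Int.natCast_nonneg k, mul_nonneg (Int.natCast_nonneg k) (Int.natCast_nonneg n)]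

/-- Terms with n > N have a negative inner argument and vanish. The free bound lets sums with
different N be compared over one range. -/
theorem sideSum_succ (k j : ℕ) {N : ℤ} {B : ℕ} (hB : N < B) :
    sideSum q (k + 1) j N = ∑ n ∈ Finset.range B,
      q ^ ((k + 1) * n ^ 2 - j * n + 2 * n * (N - (k + 1) * n) : ℤ) / qPoch q n *
        sideSum q k (min j k) (N - (k + 1) * n) := by
  have key : ∀ n : ℕ, N < n → sideSum q k (min j k) (N - (k + 1) * n) = 0 := fun n hn =>
    sideSum_of_neg _ _ (by
      nlinarith [mul_nonneg (Int.natCast_nonneg k) (Int.natCast_nonneg n)])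
  rw [sideSum]
  rcases le_total (N.toNat + 1) B with h | h
  · refine Finset.sum_subset (Finset.range_mono h) fun n _ hn => ?_
    rw [Finset.mem_range] at hn
    rw [key n (by omega), mul_zero]
  · refine (Finset.sum_subset (Finset.range_mono h) fun n _ hn => ?_).symm
    rw [Finset.mem_range] at hn
    rw [key n (by omega), mul_zero]

/-- The factor `1 - q^n` cancels the last factor of `(q)_n`, which shifts the summation index. -/
theorem sum_one_sub_pow_div_qPoch (hQ : ∀ n, qPoch q n ≠ 0) (f : ℕ → L) (B : ℕ) :
    ∑ n ∈ Finset.range (B + 1), (1 - q ^ n) / qPoch q n * f n =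
      ∑ n ∈ Finset.range B, f (n + 1) / qPoch q n := by
  rw [Finset.sum_range_succ']
  simp only [pow_zero, sub_self, zero_div, zero_mul, add_zero]
  refine Finset.sum_congr rfl fun n _ => ?_
  have h := hQ (n + 1)
  rw [qPoch_succ] at h ⊢
  have h1 := left_ne_zero_of_mul h
  have h2 := right_ne_zero_of_mul h
  field_simp

/-- Between j = 0 and j = k the exponent changes by ∂₁+⋯+∂_k, which is the constant N. -/
theorem sideSum_zero_eq (hq : q ≠ 0) (k : ℕ) (N : ℤ) :
    sideSum q k 0 N = q ^ N * sideSum q k k N := by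
  induction k generalizing N with
  | zero =>
    simp only [sideSum]
    split_ifs with h <;> simp [h]
  | succ k ih =>
    rw [sideSum, sideSum, Finset.mul_sum]
    refine Finset.sum_congr rfl fun n _ => ?_
    rw [Nat.zero_min, min_eq_right (Nat.le_succ k), ih]
    have e : q ^ ((k + 1) * n ^ 2 - (0 : ℕ) * n + 2 * n * (N - (k + 1) * n) : ℤ) *
        q ^ (N - (k + 1) * n : ℤ) =
        q ^ N * q ^ ((k + 1) * n ^ 2 - (k + 1 : ℕ) * n + 2 * n * (N - (k + 1) * n) : ℤ) := by
      rw [← zpow_add₀ hq, ← zpow_add₀ hq]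
      congr 1
      push_cast
      ring
    linear_combination (sideSum q k k (N - (k + 1) * n) / qPoch q n) * e

/-- Both sums on the left have the inner factor `sideSum q k k`, and their prefactors differ by q^n.
Cancelling 1 - q^n against (q)_n and shifting n turns N into N - (k + 1); `sideSum_zero_eq` absorbs
the remaining power of q. -/
theorem sideSum_succ_sub_top (hq : q ≠ 0) (hQ : ∀ n, qPoch q n ≠ 0) (k : ℕ) (N : ℤ) :
    sideSum q (k + 1) (k + 1) N - sideSum q (k + 1) k N =
      q ^ (N - k - 1) * sideSum q (k + 1) 0 (N - k - 1) := by
  have hB : N < ((N.toNat + 1 + 1 : ℕ) : ℤ) := by omega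
  have hB' : N - k - 1 < ((N.toNat + 1 : ℕ) : ℤ) := by omega
  rw [sideSum_succ k _ hB, sideSum_succ k _ hB, sideSum_succ k _ hB', ← Finset.sum_sub_distrib,
    Finset.mul_sum]
  have h := sum_one_sub_pow_div_qPoch hQ (fun n =>
    q ^ ((k + 1) * n ^ 2 - (k + 1 : ℕ) * n + 2 * n * (N - (k + 1) * n) : ℤ) *
      sideSum q k k (N - (k + 1) * n)) (N.toNat + 1)
  refine Eq.trans (Finset.sum_congr rfl fun n _ => ?_) (h.trans (Finset.sum_congr rfl fun n _ => ?_))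
  · rw [min_eq_right (Nat.le_succ k), min_self]
    have e : q ^ ((k + 1) * n ^ 2 - k * n + 2 * n * (N - (k + 1) * n) : ℤ) =
        q ^ n * q ^ ((k + 1) * n ^ 2 - (k + 1 : ℕ) * n + 2 * n * (N - (k + 1) * n) : ℤ) := by
      rw [← zpow_natCast, ← zpow_add₀ hq]
      congr 1
      push_cast
      ring
    rw [e]
    ring
  · rw [Nat.zero_min, sideSum_zero_eq hq]
    have e1 : N - (k + 1) * ((n + 1 : ℕ) : ℤ) = N - k - 1 - (k + 1) * n := by push_cast; ring
    have e : q ^ ((k + 1) * (n + 1 : ℕ) ^ 2 - (k + 1 : ℕ) * (n + 1 : ℕ) +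
          2 * (n + 1 : ℕ) * (N - (k + 1) * (n + 1 : ℕ)) : ℤ) =
        q ^ (N - k - 1) * (q ^ ((k + 1) * n ^ 2 - (0 : ℕ) * n +
          2 * n * (N - k - 1 - (k + 1) * n) : ℤ) * q ^ (N - k - 1 - (k + 1) * n)) := by
      rw [← zpow_add₀ hq, ← zpow_add₀ hq]
      congr 1
      push_cast
      ring
    rw [e1] at e ⊢
    rw [e]
    ring

/-- The hypothesis is symmetric in j and l, so the induction supplies the identity for (j, l) and
for (l, j). Both are applied inside the sum over the smallest entry n; the pieces left over carry 1
- q^n, or match after the shift n ↦ n + 1. Integer N and exponents allow every shift without a side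
condition. -/
theorem sideSum_succ_sub (hq : q ≠ 0) (hQ : ∀ n, qPoch q n ≠ 0) (k j l : ℕ) (h : j + l + 1 = k)
    (N : ℤ) :
    sideSum q k (j + 1) N - sideSum q k j N =
      q ^ (N - j - 1) * sideSum q k l (N - j - 1) := by
  induction k generalizing j l N with
  | zero => omega
  | succ k ih =>
    rcases l with _ | l
    · obtain rfl : j = k := by omega
      exact sideSum_succ_sub_top hq hQ j N
    · have ih₁ := ih j l (by omega)
      have ih₂ := ih l j (by omega)
      clear ih
      set B := N.toNat + 1 with hBdef
      have hB : N < ((B + 1 : ℕ) : ℤ) := by omega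
      have hB' : N - j - 1 < ((B + 1 : ℕ) : ℤ) := by omega
      have hk : (k : ℤ) = j + l + 1 := by omega
      rw [sideSum_succ k _ hB, sideSum_succ k _ hB, sideSum_succ k _ hB',
        min_eq_left (by omega : j + 1 ≤ k), min_eq_left (by omega : j ≤ k),
        min_eq_left (by omega : l + 1 ≤ k)]
      have s₁ := sum_one_sub_pow_div_qPoch hQ (fun n =>
        q ^ ((k + 1) * n ^ 2 - (j + 1 : ℕ) * n + 2 * n * (N - (k + 1) * n) : ℤ) *
          sideSum q k (j + 1) (N - (k + 1) * n)) B
      have s₂ := sum_one_sub_pow_div_qPoch hQ (fun n =>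
        q ^ (N - j - 1) * (q ^ ((k + 1) * n ^ 2 - (l + 1 : ℕ) * n +
          2 * n * (N - j - 1 - (k + 1) * n) : ℤ) *
          sideSum q k l (N - j - 1 - (k + 1) * n))) B
      -- The term n = B has a negative argument, so this unshifted sum can share the range of the
      -- shifted ones.
      have s₃ : ∑ n ∈ Finset.range (B + 1), q ^ (N - j - 1) * (q ^ ((k + 1) * n ^ 2 -
          (l + 1 : ℕ) * n + 2 * n * (N - j - 1 - (k + 1) * n) : ℤ) / qPoch q n *
          (q ^ (N - j - 1 - (k + 1) * n - l - 1) *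
            sideSum q k j (N - j - 1 - (k + 1) * n - l - 1))) =
          ∑ n ∈ Finset.range B, q ^ (N - j - 1) * (q ^ ((k + 1) * n ^ 2 -
          (l + 1 : ℕ) * n + 2 * n * (N - j - 1 - (k + 1) * n) : ℤ) / qPoch q n *
          (q ^ (N - j - 1 - (k + 1) * n - l - 1) *
            sideSum q k j (N - j - 1 - (k + 1) * n - l - 1))) := by
        rw [Finset.sum_range_succ, sideSum_of_neg, mul_zero, mul_zero, mul_zero, add_zero]
        have hNB : N < B := by omega
        nlinarith [mul_nonneg (Int.natCast_nonneg k) (Int.natCast_nonneg B)]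
      -- The three remaining sums cancel termwise by `ih₁` at N - (k + 1)(n + 1): since j + l + 2 =
      -- k + 1, that is the argument of S_j at index n in `s₃`.
      have s₄ : ∑ n ∈ Finset.range B,
          q ^ ((k + 1) * (n + 1 : ℕ) ^ 2 - (j + 1 : ℕ) * (n + 1 : ℕ) +
            2 * (n + 1 : ℕ) * (N - (k + 1) * (n + 1 : ℕ)) : ℤ) *
          sideSum q k (j + 1) (N - (k + 1) * (n + 1 : ℕ)) / qPoch q n =
          ∑ n ∈ Finset.range B, q ^ (N - j - 1) * (q ^ ((k + 1) * (n + 1 : ℕ) ^ 2 -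
          (l + 1 : ℕ) * (n + 1 : ℕ) + 2 * (n + 1 : ℕ) * (N - j - 1 - (k + 1) * (n + 1 : ℕ)) : ℤ) *
          sideSum q k l (N - j - 1 - (k + 1) * (n + 1 : ℕ))) / qPoch q n +
          ∑ n ∈ Finset.range B, q ^ (N - j - 1) * (q ^ ((k + 1) * n ^ 2 -
          (l + 1 : ℕ) * n + 2 * n * (N - j - 1 - (k + 1) * n) : ℤ) / qPoch q n *
          (q ^ (N - j - 1 - (k + 1) * n - l - 1) *
            sideSum q k j (N - j - 1 - (k + 1) * n - l - 1))) := by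
        rw [← Finset.sum_add_distrib]
        refine Finset.sum_congr rfl fun n _ => ?_
        have e := ih₁ (N - (k + 1) * (n + 1 : ℕ))
        have e1 : N - j - 1 - (k + 1) * n - l - 1 = N - (k + 1) * (n + 1 : ℕ) := by
          push_cast; rw [hk]; ring
        have e2 : N - j - 1 - (k + 1) * (n + 1 : ℕ) = N - (k + 1) * (n + 1 : ℕ) - j - 1 := by
          ring
        have e3 : q ^ (N - j - 1) * q ^ ((k + 1) * n ^ 2 -
            (l + 1 : ℕ) * n + 2 * n * (N - j - 1 - (k + 1) * n) : ℤ) *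
            q ^ (N - (k + 1) * (n + 1 : ℕ)) =
            q ^ ((k + 1) * (n + 1 : ℕ) ^ 2 - (j + 1 : ℕ) * (n + 1 : ℕ) +
            2 * (n + 1 : ℕ) * (N - (k + 1) * (n + 1 : ℕ)) : ℤ) := by
          rw [← zpow_add₀ hq, ← zpow_add₀ hq]
          congr 1
          push_cast
          rw [hk]
          ring
        have e4 : q ^ (N - j - 1) * q ^ ((k + 1) * (n + 1 : ℕ) ^ 2 -
          (l + 1 : ℕ) * (n + 1 : ℕ) +
            2 * (n + 1 : ℕ) * (N - (k + 1) * (n + 1 : ℕ) - j - 1) : ℤ) =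
            q ^ ((k + 1) * (n + 1 : ℕ) ^ 2 - (j + 1 : ℕ) * (n + 1 : ℕ) +
            2 * (n + 1 : ℕ) * (N - (k + 1) * (n + 1 : ℕ)) : ℤ) *
            q ^ (N - (k + 1) * (n + 1 : ℕ) - j - 1) := by
          rw [← zpow_add₀ hq, ← zpow_add₀ hq]
          congr 1
          push_cast
          rw [hk]
          ring
        rw [e1, e2]
        generalize q ^ ((k + 1) * (n + 1 : ℕ) ^ 2 - (j + 1 : ℕ) * (n + 1 : ℕ) +
            2 * (n + 1 : ℕ) * (N - (k + 1) * (n + 1 : ℕ)) : ℤ) = Z at e3 e4 ⊢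
        generalize sideSum q k l (N - (k + 1) * (n + 1 : ℕ) - j - 1) = Sl at e ⊢
        generalize sideSum q k j (N - (k + 1) * (n + 1 : ℕ)) = Sj at e ⊢
        linear_combination (Z / qPoch q n) * e - (Sj / qPoch q n) * e3 - (Sl / qPoch q n) * e4
      -- Rewrite S_j by `ih₁` and S_{l+1} by `ih₂`. The two resulting multiples of S_l have
      -- coefficients in ratio -q^n, by `e3`, so they too combine into a factor 1 - q^n.
      have t₁ : ∀ n : ℕ,
          q ^ ((k + 1) * n ^ 2 - (j + 1 : ℕ) * n + 2 * n * (N - (k + 1) * n) : ℤ) / qPoch q n *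
            sideSum q k (j + 1) (N - (k + 1) * n) -
          q ^ ((k + 1) * n ^ 2 - j * n + 2 * n * (N - (k + 1) * n) : ℤ) / qPoch q n *
            sideSum q k j (N - (k + 1) * n) -
          q ^ (N - j - 1) * (q ^ ((k + 1) * n ^ 2 - (l + 1 : ℕ) * n +
            2 * n * (N - j - 1 - (k + 1) * n) : ℤ) / qPoch q n *
            sideSum q k (l + 1) (N - j - 1 - (k + 1) * n)) =
          (1 - q ^ n) / qPoch q n *
            (q ^ ((k + 1) * n ^ 2 - (j + 1 : ℕ) * n + 2 * n * (N - (k + 1) * n) : ℤ) *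
            sideSum q k (j + 1) (N - (k + 1) * n)) -
          (1 - q ^ n) / qPoch q n * (q ^ (N - j - 1) * (q ^ ((k + 1) * n ^ 2 - (l + 1 : ℕ) * n +
            2 * n * (N - j - 1 - (k + 1) * n) : ℤ) *
            sideSum q k l (N - j - 1 - (k + 1) * n))) -
          q ^ (N - j - 1) * (q ^ ((k + 1) * n ^ 2 -
            (l + 1 : ℕ) * n + 2 * n * (N - j - 1 - (k + 1) * n) : ℤ) / qPoch q n *
            (q ^ (N - j - 1 - (k + 1) * n - l - 1) *
            sideSum q k j (N - j - 1 - (k + 1) * n - l - 1))) := by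
        intro n
        have e := ih₁ (N - (k + 1) * n)
        have e' := ih₂ (N - j - 1 - (k + 1) * n)
        have e1 : N - (k + 1) * n - j - 1 = N - j - 1 - (k + 1) * n := by ring
        rw [e1] at e
        have e2 : q ^ ((k + 1) * n ^ 2 - j * n + 2 * n * (N - (k + 1) * n) : ℤ) =
            q ^ n * q ^ ((k + 1) * n ^ 2 - (j + 1 : ℕ) * n + 2 * n * (N - (k + 1) * n) : ℤ) := by
          rw [← zpow_natCast, ← zpow_add₀ hq]
          congr 1
          push_cast
          ring
        have e3 : q ^ n * q ^ (N - j - 1) * q ^ ((k + 1) * n ^ 2 -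
            (l + 1 : ℕ) * n + 2 * n * (N - j - 1 - (k + 1) * n) : ℤ) =
            q ^ n * q ^ ((k + 1) * n ^ 2 - (j + 1 : ℕ) * n + 2 * n * (N - (k + 1) * n) : ℤ) *
            q ^ (N - j - 1 - (k + 1) * n) := by
          rw [← zpow_natCast, ← zpow_add₀ hq, ← zpow_add₀ hq, ← zpow_add₀ hq, ← zpow_add₀ hq]
          congr 1
          push_cast
          rw [hk]
          ring
        rw [e2]
        generalize q ^ ((k + 1) * n ^ 2 - (j + 1 : ℕ) * n + 2 * n * (N - (k + 1) * n) : ℤ) = Z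
          at e3 ⊢
        generalize q ^ ((k + 1) * n ^ 2 - (l + 1 : ℕ) * n +
            2 * n * (N - j - 1 - (k + 1) * n) : ℤ) = Y at e3 ⊢
        linear_combination (q ^ n * Z / qPoch q n) * e -
          (q ^ (N - j - 1) * Y / qPoch q n) * e' -
          (sideSum q k l (N - j - 1 - (k + 1) * n) / qPoch q n) * e3
      rw [Finset.mul_sum, ← sub_eq_zero, ← Finset.sum_sub_distrib, ← Finset.sum_sub_distrib,
        Finset.sum_congr rfl fun n _ => t₁ n, Finset.sum_sub_distrib, Finset.sum_sub_distrib,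
        s₁, s₂, s₃, s₄]
      ring

end SideSum

/-! ### The recursive sums as sums over `durfeeSides` -/

theorem mem_durfeeSides {r N : ℕ} {d : ℕ → ℕ} :
    d ∈ durfeeSides r N ↔ ∑ j ∈ Finset.Icc 1 (r - 1), d j = N ∧
      (∀ j, j ∉ Finset.Icc 1 (r - 1) → d j = 0) ∧
      ∀ j ∈ Finset.Ico 1 (r - 1), d (j + 1) ≤ d j := by
  simp only [durfeeSides, Finset.mem_filter, Finset.mem_piAntidiag, and_assoc]
  refine and_congr_right fun _ => and_congr_left fun _ => forall_congr' fun j => ?_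
  tauto

theorem last_le_of_mem_durfeeSides {r N : ℕ} {d : ℕ → ℕ} (hd : d ∈ durfeeSides r N) {j : ℕ}
    (h1 : 1 ≤ j) (h2 : j ≤ r - 1) : d (r - 1) ≤ d j := by
  obtain ⟨-, -, hd⟩ := mem_durfeeSides.1 hd
  induction h2 using Nat.decreasingInduction with
  | self => exact le_rfl
  | of_succ m hm ih =>
    exact (ih (by omega)).trans (hd m (Finset.mem_Ico.2 ⟨h1, hm⟩))

theorem length_mul_last_le {k N : ℕ} {d : ℕ → ℕ} (hd : d ∈ durfeeSides (k + 1) N) :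
    k * d k ≤ N := by
  have h := Finset.card_nsmul_le_sum (Finset.Icc 1 k) d (d k) fun j hj => by
    rw [Finset.mem_Icc] at hj
    exact last_le_of_mem_durfeeSides hd hj.1 hj.2
  have h' := (mem_durfeeSides.1 hd).1
  simp only [Nat.add_sub_cancel] at h'
  simpa [h'] using h

/-- Add `n` to each of the `k` entries of a sequence, and append another entry `n`. -/
def raiseSides (k n : ℕ) (e : ℕ → ℕ) (j : ℕ) : ℕ :=
  if j ∈ Finset.Icc 1 (k + 1) then e j + n else 0

theorem sum_raiseSides (k n : ℕ) {e : ℕ → ℕ} {j : ℕ} (hj : j ≤ k + 1) :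
    ∑ t ∈ Finset.Icc 1 j, raiseSides k n e t = ∑ t ∈ Finset.Icc 1 j, e t + j * n := by
  have : ∀ t ∈ Finset.Icc 1 j, raiseSides k n e t = e t + n := fun t ht => by
    rw [Finset.mem_Icc] at ht
    rw [raiseSides, if_pos (Finset.mem_Icc.2 (by omega))]
  rw [Finset.sum_congr rfl this, Finset.sum_add_distrib]
  simp

/-- The smallest entry n can be subtracted from all k + 1 entries; the last becomes 0 and is
forgotten. This is the bijection behind the recursion of `sideSum`. -/
theorem sum_durfeeSides_fiber {M : Type*} [AddCommMonoid M] (k n N : ℕ) (g : (ℕ → ℕ) → M) :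
    ∑ d ∈ durfeeSides (k + 2) (N + (k + 1) * n) with d (k + 1) = n, g d =
      ∑ e ∈ durfeeSides (k + 1) N, g (raiseSides k n e) := by
  symm
  refine Finset.sum_bij' (fun e _ => raiseSides k n e) (fun d _ j => d j - n) ?_ ?_ ?_ ?_ ?_
  · intro e he
    obtain ⟨h1, h2, h3⟩ := mem_durfeeSides.1 he
    simp only [Nat.add_sub_cancel] at h1 h2 h3
    have h0 : e (k + 1) = 0 := h2 _ (by simp)
    rw [Finset.mem_filter, mem_durfeeSides]
    refine ⟨⟨?_, ?_, ?_⟩, ?_⟩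
    · simp only [Nat.add_succ_sub_one]
      rw [sum_raiseSides k n le_rfl, Finset.sum_Icc_succ_top (by omega), h1, h0, add_zero]
    · intro j hj
      exact if_neg hj
    · intro j hj
      simp only [Nat.add_succ_sub_one, Finset.mem_Ico] at hj
      rw [raiseSides, raiseSides, if_pos (Finset.mem_Icc.2 (by omega)),
        if_pos (Finset.mem_Icc.2 (by omega))]
      rcases Nat.lt_or_ge j k with hjk | hjk
      · have := h3 j (Finset.mem_Ico.2 ⟨hj.1, hjk⟩)
        omega
      · have : j = k := by omega
        subst this
        omega
    · rw [raiseSides, if_pos (Finset.mem_Icc.2 (by omega)), h0, zero_add]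
  · intro d hd
    obtain ⟨hd, hn⟩ := Finset.mem_filter.1 hd
    obtain ⟨h1, h2, h3⟩ := mem_durfeeSides.1 hd
    simp only [Nat.add_succ_sub_one] at h1 h2 h3
    rw [mem_durfeeSides]
    simp only [Nat.add_sub_cancel]
    refine ⟨?_, ?_, ?_⟩
    · have h : ∀ j ∈ Finset.Icc 1 k, d j = d j - n + n := fun j hj => by
        rw [Finset.mem_Icc] at hj
        have := last_le_of_mem_durfeeSides hd hj.1 (by omega)
        simp only [Nat.add_succ_sub_one] at this
        omega
      rw [Finset.sum_Icc_succ_top (by omega), Finset.sum_congr rfl h, Finset.sum_add_distrib,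
        hn] at h1
      simp only [Finset.sum_const, Nat.card_Icc, Nat.add_sub_cancel, smul_eq_mul] at h1
      rw [add_mul, one_mul] at h1
      omega
    · intro j hj
      rcases eq_or_ne j (k + 1) with rfl | hne
      · omega
      · rw [h2 j (by simp only [Finset.mem_Icc] at hj ⊢; omega), Nat.zero_sub]
    · intro j hj
      rw [Finset.mem_Ico] at hj
      have := h3 j (Finset.mem_Ico.2 (by omega))
      omega
  · intro e he
    obtain ⟨-, h2, -⟩ := mem_durfeeSides.1 he
    simp only [Nat.add_sub_cancel] at h2
    funext j
    simp only [raiseSides]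
    split_ifs with h
    · omega
    · rw [h2 j (fun h' => h (by rw [Finset.mem_Icc] at h' ⊢; omega)), Nat.zero_sub]
  · intro d hd
    obtain ⟨hd, hn⟩ := Finset.mem_filter.1 hd
    obtain ⟨-, h2, -⟩ := mem_durfeeSides.1 hd
    funext j
    simp only [raiseSides]
    split_ifs with h
    · rw [Finset.mem_Icc] at h
      have := last_le_of_mem_durfeeSides hd h.1 (by omega)
      simp only [Nat.add_succ_sub_one] at this
      omega
    · exact (h2 j h).symm
  · intro e _
    rfl

section SideTerm

variable {L : Type*} [Field L] {q : L}

/-- The term `q^{∂₁²+⋯+∂_k² - ∂₁-⋯-∂_j} / ((q)_{∂₁-∂₂} ⋯ (q)_{∂_k - ∂_{k+1}})` in a field. -/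
def sideTerm (q : L) (k j : ℕ) (d : ℕ → ℕ) : L :=
  q ^ (∑ t ∈ Finset.Icc 1 k, (d t : ℤ) ^ 2 - ∑ t ∈ Finset.Icc 1 j, (d t : ℤ)) /
    ∏ t ∈ Finset.Icc 1 k, qPoch q (d t - d (t + 1))

theorem sideTerm_raiseSides (hq : q ≠ 0) (k n : ℕ) {j N : ℕ} (hj : j ≤ k + 1) {e : ℕ → ℕ}
    (he : e ∈ durfeeSides (k + 1) N) :
    sideTerm q (k + 1) j (raiseSides k n e) =
      q ^ ((k + 1) * n ^ 2 - j * n + 2 * n * N : ℤ) / qPoch q n * sideTerm q k (min j k) e := by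
  obtain ⟨h1, h2, -⟩ := mem_durfeeSides.1 he
  simp only [Nat.add_sub_cancel] at h1 h2
  have h0 : e (k + 1) = 0 := h2 _ (by simp)
  have hr : ∀ t ∈ Finset.Icc 1 (k + 1), raiseSides k n e t = e t + n := fun t ht => if_pos ht
  have hlin : ∑ t ∈ Finset.Icc 1 j, (raiseSides k n e t : ℤ) =
      ∑ t ∈ Finset.Icc 1 (min j k), (e t : ℤ) + j * n := by
    have h := sum_raiseSides k n (e := e) hj
    have h' : ∑ t ∈ Finset.Icc 1 j, e t = ∑ t ∈ Finset.Icc 1 (min j k), e t := by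
      rcases Nat.lt_or_ge k j with hjk | hjk
      · obtain rfl : j = k + 1 := by omega
        rw [Finset.sum_Icc_succ_top (by omega), h0, min_eq_right (by omega), add_zero]
      · rw [min_eq_left hjk]
    rw [h'] at h
    exact_mod_cast h
  have hsq : ∑ t ∈ Finset.Icc 1 (k + 1), (raiseSides k n e t : ℤ) ^ 2 =
      ∑ t ∈ Finset.Icc 1 k, (e t : ℤ) ^ 2 + (k + 1) * n ^ 2 + 2 * n * N := by
    have h : ∀ t ∈ Finset.Icc 1 (k + 1), (raiseSides k n e t : ℤ) ^ 2 =
        (e t : ℤ) ^ 2 + 2 * n * e t + n ^ 2 := fun t ht => by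
      rw [hr t ht]
      push_cast
      ring
    rw [Finset.sum_congr rfl h, Finset.sum_add_distrib, Finset.sum_add_distrib,
      ← Finset.mul_sum, Finset.sum_Icc_succ_top (by omega), Finset.sum_Icc_succ_top (by omega),
      h0, ← h1]
    simp
    ring
  have hprod : ∏ t ∈ Finset.Icc 1 (k + 1),
      qPoch q (raiseSides k n e t - raiseSides k n e (t + 1)) =
      (∏ t ∈ Finset.Icc 1 k, qPoch q (e t - e (t + 1))) * qPoch q n := by
    rw [Finset.prod_Icc_succ_top (by omega), hr (k + 1) (by simp), h0, raiseSides,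
      if_neg (by simp), zero_add, Nat.sub_zero]
    refine congrArg₂ _ (Finset.prod_congr rfl fun t ht => ?_) rfl
    rw [Finset.mem_Icc] at ht
    rw [hr t (Finset.mem_Icc.2 (by omega)), hr (t + 1) (Finset.mem_Icc.2 (by omega)),
      Nat.add_sub_add_right]
  rw [sideTerm, sideTerm, hlin, hsq, hprod, div_mul_div_comm, ← zpow_add₀ hq, mul_comm (qPoch q n)]
  congr 2
  ring

theorem sideSum_eq_sum_durfeeSides (hq : q ≠ 0) {k j : ℕ} (hj : j ≤ k) (N : ℕ) :
    sideSum q k j N = ∑ d ∈ durfeeSides (k + 1) N, sideTerm q k j d := by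
  induction k generalizing j N with
  | zero =>
    obtain rfl : j = 0 := by omega
    rcases Nat.eq_zero_or_pos N with rfl | hN
    · have : durfeeSides 1 0 = {0} := by
        ext d
        rw [mem_durfeeSides]
        simp [funext_iff]
      simp [sideSum, sideTerm, this]
    · have : durfeeSides 1 N = ∅ := by
        ext d
        rw [mem_durfeeSides]
        simp [hN.ne]
      simp [sideSum, this, hN.ne']
  | succ k ih =>
    rw [sideSum, Int.toNat_natCast]
    have hmaps : ∀ d ∈ durfeeSides (k + 1 + 1) N, d (k + 1) ∈ Finset.range (N + 1) := fun d hd => by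
      have := length_mul_last_le (k := k + 1) hd
      exact Finset.mem_range.2 (Nat.lt_succ_of_le
        ((Nat.le_mul_of_pos_left _ (Nat.succ_pos k)).trans this))
    rw [← Finset.sum_fiberwise_of_maps_to hmaps]
    refine Finset.sum_congr rfl fun n _ => ?_
    -- If (k + 1)n > N, no sequence of sum N has smallest entry n, and the inner `sideSum` has a
    -- negative argument: both sides are 0.
    rcases Nat.lt_or_ge N ((k + 1) * n) with h | h
    · rw [sideSum_of_neg _ _ (by rw [sub_neg]; exact_mod_cast h), mul_zero, eq_comm]
      refine Finset.sum_eq_zero fun d hd => ?_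
      have hd' := Finset.mem_filter.1 hd
      have hle := length_mul_last_le (k := k + 1) hd'.1
      rw [hd'.2] at hle
      exact absurd hle h.not_ge
    · obtain ⟨M, rfl⟩ := Nat.exists_eq_add_of_le' h
      have hM : ((M + (k + 1) * n : ℕ) : ℤ) - (k + 1) * n = (M : ℕ) := by push_cast; ring
      rw [sum_durfeeSides_fiber, hM, ih (min_le_right _ _), Finset.mul_sum]
      exact Finset.sum_congr rfl fun e he => (sideTerm_raiseSides hq k n hj he).symm

end SideTerm

/-! ### Transfer to power series through the fraction field -/

theorem constantCoeff_qFactorial (n : ℕ) : constantCoeff (qFactorial n) = 1 := by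
  rw [qFactorial, map_prod]
  refine Finset.prod_eq_one fun j hj => ?_
  rw [Finset.mem_Icc] at hj
  simp [zero_pow (by omega : j ≠ 0)]

section Fraction

/-- The indeterminate `q`, in the field of fractions of the power series ring. -/
noncomputable def fracX : FractionRing ℚ⟦X⟧ := algebraMap ℚ⟦X⟧ (FractionRing ℚ⟦X⟧) X

theorem fracX_ne_zero : fracX ≠ 0 :=
  (map_ne_zero_iff _ (IsFractionRing.injective ℚ⟦X⟧ (FractionRing ℚ⟦X⟧))).2 X_ne_zero

theorem algebraMap_qFactorial (n : ℕ) :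
    algebraMap ℚ⟦X⟧ (FractionRing ℚ⟦X⟧) (qFactorial n) = qPoch fracX n := by
  simp [qFactorial, qPoch, fracX, map_prod]

theorem qPoch_fracX_ne_zero (n : ℕ) : qPoch fracX n ≠ 0 := by
  rw [← algebraMap_qFactorial, map_ne_zero_iff _ (IsFractionRing.injective _ _)]
  intro h
  have := constantCoeff_qFactorial n
  simp [h] at this

theorem algebraMap_inv_prod_qFactorial (s : Finset ℕ) (g : ℕ → ℕ) :
    algebraMap ℚ⟦X⟧ (FractionRing ℚ⟦X⟧) (∏ t ∈ s, qFactorial (g t))⁻¹ =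
      (∏ t ∈ s, qPoch fracX (g t))⁻¹ := by
  have h : constantCoeff (∏ t ∈ s, qFactorial (g t)) ≠ 0 := by
    rw [map_prod]
    simp [constantCoeff_qFactorial]
  refine eq_inv_of_mul_eq_one_left ?_
  simp only [← algebraMap_qFactorial, ← map_prod, ← map_mul]
  rw [PowerSeries.inv_mul_cancel _ h, map_one]

end Fraction

/-- Ensures that the natural-number exponents do not truncate, hence agree with the integer
exponents of `sideTerm`. -/
theorem sum_Icc_le_sum_sq {k N j : ℕ} {d : ℕ → ℕ} (hd : d ∈ durfeeSides (k + 1) N) :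
    ∑ t ∈ Finset.Icc 1 j, d t ≤ ∑ t ∈ Finset.Icc 1 k, d t ^ 2 := by
  obtain ⟨-, h2, -⟩ := mem_durfeeSides.1 hd
  simp only [Nat.add_sub_cancel] at h2
  calc ∑ t ∈ Finset.Icc 1 j, d t ≤ ∑ t ∈ Finset.Icc 1 k, d t :=
        Finset.sum_le_sum_of_ne_zero fun t _ h => by
          by_contra h'
          exact h (h2 t h')
    _ ≤ _ := Finset.sum_le_sum fun t _ => Nat.le_self_pow two_ne_zero _

/-- The series `∑ q^{m + ∂₁²+⋯+∂_k² - ∂₁-⋯-∂_c} / ((q)_{∂₁-∂₂} ⋯ (q)_{∂_k})` over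
`∂₁ ≥ ⋯ ≥ ∂_k ≥ 0` with sum `m`. -/
noncomputable def gordonSeries (k c m : ℕ) : ℚ⟦X⟧ :=
  X ^ m * ∑ d ∈ durfeeSides (k + 1) m,
    X ^ (∑ t ∈ Finset.Icc 1 k, d t ^ 2 - ∑ t ∈ Finset.Icc 1 c, d t) *
      (∏ t ∈ Finset.Icc 1 k, qFactorial (d t - d (t + 1)))⁻¹

theorem algebraMap_summand {k N : ℕ} {d : ℕ → ℕ} (hd : d ∈ durfeeSides (k + 1) N) (j : ℕ) :
    algebraMap ℚ⟦X⟧ (FractionRing ℚ⟦X⟧)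
      (X ^ (∑ t ∈ Finset.Icc 1 k, d t ^ 2 - ∑ t ∈ Finset.Icc 1 j, d t) *
        (∏ t ∈ Finset.Icc 1 k, qFactorial (d t - d (t + 1)))⁻¹) = sideTerm fracX k j d := by
  rw [map_mul, algebraMap_inv_prod_qFactorial _ (fun t => d t - d (t + 1)), map_pow,
    sideTerm, div_eq_mul_inv, ← fracX, ← zpow_natCast, Nat.cast_sub (sum_Icc_le_sum_sq hd)]
  push_cast
  rfl

theorem algebraMap_gordonSeries {k c : ℕ} (hc : c ≤ k) (m : ℕ) :
    algebraMap ℚ⟦X⟧ (FractionRing ℚ⟦X⟧) (gordonSeries k c m) =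
      fracX ^ m * sideSum fracX k c m := by
  rw [gordonSeries, map_mul, map_pow, ← fracX, map_sum,
    sideSum_eq_sum_durfeeSides fracX_ne_zero hc,
    Finset.sum_congr rfl fun d hd => algebraMap_summand hd c]

theorem gordonSeries_zero_left (k m : ℕ) : gordonSeries k 0 m = X ^ m * gordonSeries k k m := by
  apply IsFractionRing.injective ℚ⟦X⟧ (FractionRing ℚ⟦X⟧)
  rw [map_mul, map_pow, algebraMap_gordonSeries (Nat.zero_le k), algebraMap_gordonSeries le_rfl,
    sideSum_zero_eq fracX_ne_zero, zpow_natCast, ← fracX]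

theorem gordonSeries_succ_of_lt {k c m : ℕ} (hc : c + 1 ≤ k) (hm : m < c + 1) :
    gordonSeries k (c + 1) m = gordonSeries k c m := by
  apply IsFractionRing.injective ℚ⟦X⟧ (FractionRing ℚ⟦X⟧)
  have h := sideSum_succ_sub fracX_ne_zero qPoch_fracX_ne_zero k c (k - (c + 1)) (by omega) m
  rw [sideSum_of_neg k (k - (c + 1)) (by omega : (m : ℤ) - c - 1 < 0), mul_zero,
    sub_eq_zero] at h
  rw [algebraMap_gordonSeries hc, algebraMap_gordonSeries (by omega), h]

theorem gordonSeries_succ {k c m : ℕ} (hc : c + 1 ≤ k) :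
    gordonSeries k (c + 1) (m + (c + 1)) = gordonSeries k c (m + (c + 1)) +
      X ^ (m + (c + 1)) * gordonSeries k (k - (c + 1)) m := by
  apply IsFractionRing.injective ℚ⟦X⟧ (FractionRing ℚ⟦X⟧)
  have h := sideSum_succ_sub fracX_ne_zero qPoch_fracX_ne_zero k c (k - (c + 1)) (by omega)
    (m + (c + 1) : ℕ)
  have e : ((m + (c + 1) : ℕ) : ℤ) - c - 1 = (m : ℕ) := by push_cast; ring
  rw [e, zpow_natCast] at h
  rw [map_add, map_mul, map_pow, algebraMap_gordonSeries hc, algebraMap_gordonSeries (by omega),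
    algebraMap_gordonSeries (by omega), ← fracX]
  linear_combination fracX ^ (m + (c + 1)) * h

theorem gordonSeries_zero_right (k c : ℕ) : gordonSeries k c 0 = 1 := by
  have : durfeeSides (k + 1) 0 = {0} := by
    ext d
    rw [mem_durfeeSides, Finset.mem_singleton]
    refine ⟨fun h => funext fun j => ?_, fun h => by simp [h]⟩
    by_cases hj : j ∈ Finset.Icc 1 (k + 1 - 1)
    · exact Finset.sum_eq_zero_iff.1 h.1 j hj
    · exact h.2.1 j hj
  simp [gordonSeries, this, qFactorial]

/-- With k = c + j, multiplying by 1 - q^{∂_j} for j > 0 gives the difference of the sums with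
linear parts ∂₁+⋯+∂_j and ∂₁+⋯+∂_{j-1}, so `sideSum_succ_sub` applies from right to left. For j = 0
the factor is 1 and `sideSum_zero_eq` suffices. -/
theorem sum_gordonSummand {k c : ℕ} (hk : 1 ≤ k) (hc : c ≤ k) (m : ℕ) :
    ∑ d ∈ durfeeSides (k + 1) (m + (k + 1) - (c + 1)), gordonSummand (k + 1) (c + 1) d =
      gordonSeries k c m := by
  obtain ⟨j, rfl⟩ := Nat.exists_eq_add_of_le hc
  have hN : m + (c + j + 1) - (c + 1) = m + j := by omega
  rw [hN]
  rcases j with _ | j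
  · rw [add_zero, add_zero]
    refine Eq.trans (Finset.sum_congr rfl fun d _ => ?_)
      (b := ∑ d ∈ durfeeSides (c + 1) m, X ^ (∑ t ∈ Finset.Icc 1 c, d t ^ 2 -
        ∑ t ∈ Finset.Icc 1 0, d t) * (∏ t ∈ Finset.Icc 1 c, qFactorial (d t - d (t + 1)))⁻¹) ?_
    · simp [gordonSummand, lastFactor]
    · apply IsFractionRing.injective ℚ⟦X⟧ (FractionRing ℚ⟦X⟧)
      rw [map_sum, Finset.sum_congr rfl fun d hd => algebraMap_summand hd 0,
        ← sideSum_eq_sum_durfeeSides fracX_ne_zero (Nat.zero_le _),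
        algebraMap_gordonSeries le_rfl, sideSum_zero_eq fracX_ne_zero, zpow_natCast]
  · apply IsFractionRing.injective ℚ⟦X⟧ (FractionRing ℚ⟦X⟧)
    have h := sideSum_succ_sub fracX_ne_zero qPoch_fracX_ne_zero (c + (j + 1)) j c (by omega)
      (m + (j + 1) : ℕ)
    have e : ((m + (j + 1) : ℕ) : ℤ) - j - 1 = (m : ℕ) := by push_cast; ring
    rw [e, zpow_natCast] at h
    rw [algebraMap_gordonSeries (by omega), ← h, sideSum_eq_sum_durfeeSides fracX_ne_zero (by omega),
      sideSum_eq_sum_durfeeSides fracX_ne_zero (by omega), ← Finset.sum_sub_distrib, map_sum]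
    refine Finset.sum_congr rfl fun d hd => ?_
    have hle := sum_Icc_le_sum_sq hd (j := j + 1)
    rw [← algebraMap_summand hd, ← algebraMap_summand hd, ← map_sub]
    congr 1
    have h1 : c + (j + 1) + 1 - (c + 1) = j + 1 := by omega
    rw [gordonSummand, lastFactor, if_neg (by omega), h1, Nat.add_sub_cancel]
    rw [Finset.sum_Icc_succ_top (by omega)] at hle ⊢
    have h2 : ∑ t ∈ Finset.Icc 1 (c + (j + 1)), d t ^ 2 - ∑ t ∈ Finset.Icc 1 j, d t =
      (∑ t ∈ Finset.Icc 1 (c + (j + 1)), d t ^ 2 - (∑ t ∈ Finset.Icc 1 j, d t + d (j + 1))) +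
        d (j + 1) := by omega
    rw [h2, pow_add]
    ring

/-! ### Uniqueness for the recurrence -/

/-- The recurrence satisfied by the Gordon series has only one solution. -/
theorem eq_of_gordon_recurrence {k : ℕ} {F G : ℕ → ℕ → ℚ⟦X⟧}
    (hF₀ : ∀ c ≤ k, F c 0 = 1) (hG₀ : ∀ c ≤ k, G c 0 = 1)
    (hF₁ : ∀ m, F 0 m = X ^ m * F k m) (hG₁ : ∀ m, G 0 m = X ^ m * G k m)
    (hF₂ : ∀ c m, c + 1 ≤ k → m < c + 1 → F (c + 1) m = F c m)
    (hG₂ : ∀ c m, c + 1 ≤ k → m < c + 1 → G (c + 1) m = G c m)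
    (hF₃ : ∀ c m, c + 1 ≤ k → F (c + 1) (m + (c + 1)) = F c (m + (c + 1)) +
      X ^ (m + (c + 1)) * F (k - (c + 1)) m)
    (hG₃ : ∀ c m, c + 1 ≤ k → G (c + 1) (m + (c + 1)) = G c (m + (c + 1)) +
      X ^ (m + (c + 1)) * G (k - (c + 1)) m) {c : ℕ} (hc : c ≤ k) (m : ℕ) :
    F c m = G c m := by
  ext n
  induction n using Nat.strong_induction_on generalizing c m with
  | _ n ihn =>
    -- A positive power of X lowers the coefficient index, so the outer induction covers every c'
    -- and b. The inner induction on c only has to descend to c = 0, at fixed m > 0.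
    have shift : ∀ a b c', c' ≤ k → 0 < a →
        coeff n (X ^ a * F c' b) = coeff n (X ^ a * G c' b) := fun a b c' hc' ha => by
      rw [coeff_X_pow_mul', coeff_X_pow_mul']
      split_ifs with h
      · exact ihn (n - a) (by omega) hc' b
      · rfl
    rcases Nat.eq_zero_or_pos m with rfl | hm
    · rw [hF₀ c hc, hG₀ c hc]
    · induction c with
      | zero =>
        rw [hF₁, hG₁]
        exact shift m m k le_rfl hm
      | succ c ihc =>
        rcases Nat.lt_or_ge m (c + 1) with h | h
        · rw [hF₂ c m hc h, hG₂ c m hc h]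
          exact ihc (by omega)
        · obtain ⟨m, rfl⟩ := Nat.exists_eq_add_of_le' h
          rw [hF₃ c m hc, hG₃ c m hc, map_add, map_add, ihc (by omega),
            shift _ _ _ (Nat.sub_le _ _) hm]

/-! ### The difference condition in terms of multiplicities -/

theorem add_le_of_strictMono_fin {a b : ℕ} {f : Fin a → Fin b} (hf : StrictMono f) (ha : 0 < a)
    (i : ℕ) (hi : i < a) : (f ⟨0, ha⟩ : ℕ) + i ≤ f ⟨i, hi⟩ := by
  induction i with
  | zero => simp
  | succ i ih =>
    have h1 := ih (by omega)
    have h2 : f ⟨i, by omega⟩ < f ⟨i + 1, hi⟩ := hf (by simp [Fin.lt_def])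
    rw [Fin.lt_def] at h2
    omega

theorem count_add_count_succ (l : List ℕ) (t : ℕ) :
    l.count t + l.count (t + 1) = l.countP fun x => x = t ∨ x = t + 1 := by
  induction l with
  | nil => simp
  | cons a l ih =>
    simp only [List.count_cons, List.countP_cons, ← ih, beq_iff_eq, decide_eq_true_eq]
    split_ifs <;> omega

/-- In a non-increasing list, entries at distance `k` differ by at least `2` if and only if every
pair of consecutive integers accounts for at most `k` entries. -/
theorem forall_getElem_add_two_le_iff {l : List ℕ} (hl : l.Pairwise (· ≥ ·)) (k : ℕ) :
    (∀ (j : ℕ) (h : j + k < l.length), l[j + k] + 2 ≤ l[j]) ↔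
      ∀ t, l.count t + l.count (t + 1) ≤ k := by
  have anti : ∀ (a b : ℕ) (hb : b < l.length) (hab : a ≤ b), l[b] ≤ l[a] := fun a b hb hab => by
    rcases hab.eq_or_lt with rfl | hab
    · exact le_rfl
    · exact List.pairwise_iff_getElem.1 hl a b (by omega) hb hab
  constructor
  · intro h t
    by_contra! hk
    rw [count_add_count_succ, List.countP_eq_length_filter] at hk
    -- More than k entries lie in {t, t + 1}. The first and the one k later in this sublist sit at
    -- positions at least k apart in `l`, so by monotonicity the entry k places after the first is
    -- still at least t, while the first is at most t + 1.
    obtain ⟨f, hf⟩ := List.sublist_iff_exists_fin_orderEmbedding_get_eq.1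
      (List.filter_sublist (l := l) (p := fun x => decide (x = t ∨ x = t + 1)))
    have mem : ∀ i : Fin _, l.get (f i) = t ∨ l.get (f i) = t + 1 := fun i => by
      rw [← hf i]
      simpa using (List.mem_filter.1 (List.get_mem _ i)).2
    have h1 := add_le_of_strictMono_fin f.strictMono (by omega) k hk
    have h2 := mem ⟨0, by omega⟩
    have h3 := mem ⟨k, hk⟩
    have h4 := (f ⟨k, hk⟩).2
    have h5 := h (f ⟨0, by omega⟩) (by omega)
    have h6 := anti _ _ h4 h1
    simp only [List.get_eq_getElem] at h2 h3
    omega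
  · intro h j hj
    by_contra! hlt
    -- The k + 1 entries from position j to j + k lie between l[j + k] and l[j + k] + 1, too many
    -- for t = l[j + k].
    have hsub : ((l.drop j).take (k + 1)).Sublist l :=
      (List.take_sublist _ _).trans (List.drop_sublist _ _)
    have hlen : ((l.drop j).take (k + 1)).length = k + 1 := by
      rw [List.length_take, List.length_drop]
      omega
    have hall : ∀ x ∈ (l.drop j).take (k + 1), decide (x = l[j + k] ∨ x = l[j + k] + 1) = true := by
      intro x hx
      obtain ⟨i, hi, rfl⟩ := List.getElem_of_mem hx
      rw [hlen] at hi
      simp only [List.getElem_take, List.getElem_drop, decide_eq_true_eq]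
      have h1 := anti (j + i) (j + k) hj (by omega)
      have h2 := anti j (j + i) (by omega) (by omega)
      omega
    have h1 := hsub.countP_le (p := fun x => decide (x = l[j + k] ∨ x = l[j + k] + 1))
    rw [List.countP_eq_length.2 hall, hlen, ← count_add_count_succ] at h1
    have := h l[j + k]
    omega

/-! ### Removing the ones from a partition -/

/-- Multisets of `m` positive integers with sum `n`, in which every pair of consecutive integers
accounts for at most `k` elements and `1` occurs at most `c` times. -/
def gordonMultisets (k c m n : ℕ) : Set (Multiset ℕ) :=
  {s | 0 ∉ s ∧ s.sum = n ∧ s.card = m ∧ (∀ t, s.count t + s.count (t + 1) ≤ k) ∧ s.count 1 ≤ c}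

theorem gordonCount_eq_ncard (k c m n : ℕ) :
    gordonCount (k + 1) (c + 1) m n = (gordonMultisets k c m n).ncard := by
  rw [gordonCount, ← Set.ncard_image_of_injective _
    (fun p q h => Nat.Partition.ext h : Function.Injective (Nat.Partition.parts (n := n)))]
  congr 1
  have hcount : ∀ (s : Multiset ℕ) (t : ℕ), (s.sort (· ≥ ·)).count t = s.count t := fun s t => by
    rw [← Multiset.coe_count, Multiset.sort_eq]
  have key : ∀ s : Multiset ℕ, (∀ (j : ℕ) (h : j + k < (s.sort (· ≥ ·)).length),
      (s.sort (· ≥ ·))[j + k] + 2 ≤ (s.sort (· ≥ ·))[j]) ↔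
      ∀ t, s.count t + s.count (t + 1) ≤ k := fun s => by
    rw [forall_getElem_add_two_le_iff (Multiset.pairwise_sort s (· ≥ ·))]
    simp only [hcount]
  ext s
  simp only [Set.mem_image, Set.mem_ofPred_eq, gordonSet, partsList, gordonMultisets,
    Nat.add_sub_cancel, key]
  constructor
  · rintro ⟨p, ⟨⟨h1, h2⟩, h3⟩, rfl⟩
    exact ⟨fun h => (p.parts_pos h).ne' rfl, p.parts_sum, h3, h1, h2⟩
  · rintro ⟨h0, hs, hm, h1, h2⟩
    exact ⟨⟨s, fun {i} hi => Nat.pos_of_ne_zero fun h => h0 (h ▸ hi), hs⟩, ⟨⟨h1, h2⟩, hm⟩, rfl⟩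

theorem finite_gordonMultisets (k c m n : ℕ) : (gordonMultisets k c m n).Finite := by
  refine (Set.finite_range (Nat.Partition.parts (n := n))).subset ?_
  rintro s ⟨h0, hs, -⟩
  exact ⟨⟨s, fun {i} hi => Nat.pos_of_ne_zero fun h => h0 (h ▸ hi), hs⟩, rfl⟩

/-- The members of `gordonMultisets k c m n` in which `1` occurs exactly `c` times. -/
def gordonMultisetsExact (k c m n : ℕ) : Set (Multiset ℕ) :=
  {s | s ∈ gordonMultisets k c m n ∧ s.count 1 = c}

theorem card_le_sum_of_zero_notMem {s : Multiset ℕ} (hs : 0 ∉ s) : s.card ≤ s.sum := by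
  have := Multiset.card_nsmul_le_sum (s := s) (a := 1) fun x hx =>
    Nat.pos_of_ne_zero fun h => hs (h ▸ hx)
  simpa using this

/-- Increase every element by `1` and adjoin `c` elements equal to `1`. -/
def raiseMultiset (c : ℕ) (u : Multiset ℕ) : Multiset ℕ :=
  (Multiset.replicate c 0 + u).map Nat.succ

theorem raiseMultiset_injective (c : ℕ) : Function.Injective (raiseMultiset c) := fun _ _ h =>
  add_left_cancel (Multiset.map_injective Nat.succ_injective h)

theorem count_succ_raiseMultiset (c : ℕ) (u : Multiset ℕ) (t : ℕ) :
    (raiseMultiset c u).count (t + 1) = (if t = 0 then c else 0) + u.count t := by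
  rw [raiseMultiset, ← Nat.succ_eq_add_one, Multiset.count_map_eq_count' _ _ Nat.succ_injective,
    Multiset.count_add, Multiset.count_replicate]
  simp only [eq_comm]

theorem zero_notMem_raiseMultiset (c : ℕ) (u : Multiset ℕ) : 0 ∉ raiseMultiset c u := by
  rw [raiseMultiset, Multiset.mem_map]
  rintro ⟨x, -, hx⟩
  exact Nat.succ_ne_zero x hx

theorem card_raiseMultiset (c : ℕ) (u : Multiset ℕ) : (raiseMultiset c u).card = u.card + c := by
  simp [raiseMultiset, add_comm]

theorem sum_raiseMultiset (c : ℕ) (u : Multiset ℕ) :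
    (raiseMultiset c u).sum = u.sum + (u.card + c) := by
  have h : ∀ v : Multiset ℕ, (v.map Nat.succ).sum = v.sum + v.card := fun v => by
    induction v using Multiset.induction with
    | empty => simp
    | cons a v ih =>
      rw [Multiset.map_cons, Multiset.sum_cons, ih, Multiset.sum_cons, Multiset.card_cons]
      omega
  rw [raiseMultiset, h]
  simp [add_comm]

/-- Lower every element by 1 and discard the zeros, which come exactly from the ones of `s`. -/
theorem exists_raiseMultiset_eq {s : Multiset ℕ} (hs : 0 ∉ s) :
    ∃ u : Multiset ℕ, 0 ∉ u ∧ raiseMultiset (s.count 1) u = s := by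
  have h : (s.map Nat.pred).map Nat.succ = s := by
    rw [Multiset.map_map]
    conv_rhs => rw [← Multiset.map_id s]
    exact Multiset.map_congr rfl fun x hx =>
      Nat.succ_pred_eq_of_ne_zero fun h => hs (h ▸ hx)
  generalize s.map Nat.pred = v at h
  subst h
  refine ⟨v.filter fun x => ¬ x = 0, by simp, ?_⟩
  have h1 : (v.map Nat.succ).count 1 = v.count 0 :=
    Multiset.count_map_eq_count' _ _ Nat.succ_injective 0
  rw [raiseMultiset, h1, ← Multiset.filter_eq', Multiset.filter_add_not]

/-- Raising shifts the conditions on consecutive pairs by one. The pair (1, 2) upstairs becomes c +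
`u.count 1` ≤ k, which is the source of the bound k - c; the pair (0, 1) upstairs is just c ≤ k. -/
theorem raiseMultiset_mem_iff {k c : ℕ} (hc : c ≤ k) {m n : ℕ} {u : Multiset ℕ} (hu : 0 ∉ u) :
    raiseMultiset c u ∈ gordonMultisetsExact k c (m + c) (n + (m + c)) ↔
      u ∈ gordonMultisets k (k - c) m n := by
  have h0 : (raiseMultiset c u).count 0 = 0 :=
    Multiset.count_eq_zero.2 (zero_notMem_raiseMultiset c u)
  have hu0 : u.count 0 = 0 := Multiset.count_eq_zero.2 hu
  have h1 : (raiseMultiset c u).count 1 = c := by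
    rw [count_succ_raiseMultiset c u 0, if_pos rfl, hu0, add_zero]
  simp only [gordonMultisetsExact, gordonMultisets, Set.mem_ofPred_eq, h1, le_refl, and_true,
    sum_raiseMultiset, card_raiseMultiset, hu, zero_notMem_raiseMultiset, not_false_eq_true,
    true_and]
  have h2 : ∀ t, (raiseMultiset c u).count (t + 2) = u.count (t + 1) := fun t => by
    rw [count_succ_raiseMultiset c u (t + 1), if_neg (Nat.succ_ne_zero t), zero_add]
  constructor
  · rintro ⟨hs, hm, ht⟩
    have ht1 : c + u.count 1 ≤ k := by
      have := ht 1
      rwa [h1, h2 0] at this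
    refine ⟨by omega, by omega, fun t => ?_, by omega⟩
    rcases t with _ | t
    · rw [hu0, zero_add, zero_add]
      omega
    · have := ht (t + 2)
      rwa [h2 t, h2 (t + 1)] at this
  · rintro ⟨hs, hm, ht, h1'⟩
    refine ⟨by omega, by omega, fun t => ?_⟩
    rcases t with _ | _ | t
    · rw [h0, h1]
      omega
    · rw [zero_add, h1, h2 0, zero_add]
      omega
    · rw [h2 t, h2 (t + 1)]
      exact ht (t + 1)

theorem ncard_gordonMultisetsExact {k c : ℕ} (hc : c ≤ k) (m n : ℕ) :
    (gordonMultisetsExact k c (m + c) (n + (m + c))).ncard =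
      (gordonMultisets k (k - c) m n).ncard := by
  rw [← Set.ncard_image_of_injective (gordonMultisets k (k - c) m n) (raiseMultiset_injective c)]
  congr 1
  ext s
  constructor
  · intro hs
    obtain ⟨u, hu, h⟩ := exists_raiseMultiset_eq hs.1.1
    rw [hs.2] at h
    subst h
    exact ⟨u, (raiseMultiset_mem_iff hc hu).1 hs, rfl⟩
  · rintro ⟨u, hu, rfl⟩
    exact (raiseMultiset_mem_iff hc hu.1).2 hu

theorem gordonMultisetsExact_zero (k m n : ℕ) :
    gordonMultisetsExact k 0 m n = gordonMultisets k 0 m n := by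
  ext s
  exact ⟨fun h => h.1, fun h => ⟨h, Nat.le_zero.1 h.2.2.2.2⟩⟩

theorem ncard_gordonMultisets_succ (k c m n : ℕ) :
    (gordonMultisets k (c + 1) m n).ncard =
      (gordonMultisets k c m n).ncard + (gordonMultisetsExact k (c + 1) m n).ncard := by
  rw [← Set.ncard_union_eq _ (finite_gordonMultisets _ _ _ _)
    ((finite_gordonMultisets k (c + 1) m n).subset fun s hs => hs.1)]
  · congr 1
    ext s
    simp only [gordonMultisetsExact, gordonMultisets, Set.mem_ofPred_eq, Set.mem_union]
    constructor
    · rintro ⟨h1, h2, h3, h4, h5⟩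
      rcases h5.lt_or_eq with h | h
      · exact Or.inl ⟨h1, h2, h3, h4, by omega⟩
      · exact Or.inr ⟨⟨h1, h2, h3, h4, h5⟩, h⟩
    · rintro (⟨h1, h2, h3, h4, h5⟩ | h)
      · exact ⟨h1, h2, h3, h4, by omega⟩
      · exact h.1
  · rw [Set.disjoint_left]
    rintro s ⟨-, -, -, -, h⟩ ⟨-, h'⟩
    omega

/-! ### Recurrence for the partition generating functions, and conclusion -/

/-- The generating function of partitions counted by `gordonMultisets`. -/
noncomputable def gordonGenFun (k c m : ℕ) : ℚ⟦X⟧ :=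
  PowerSeries.mk fun n => ((gordonMultisets k c m n).ncard : ℚ)

theorem mk_ncard_gordonMultisetsExact {k c : ℕ} (hc : c ≤ k) (m : ℕ) :
    PowerSeries.mk (fun n => ((gordonMultisetsExact k c (m + c) n).ncard : ℚ)) =
      X ^ (m + c) * gordonGenFun k (k - c) m := by
  ext n
  rw [coeff_X_pow_mul', coeff_mk]
  split_ifs with h
  · obtain ⟨n, rfl⟩ := Nat.exists_eq_add_of_le' h
    rw [Nat.add_sub_cancel, gordonGenFun, coeff_mk, ncard_gordonMultisetsExact hc]
  -- Positive parts force the sum n to be at least the number of parts m + c, so lower coefficients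
  -- vanish.
  · have : gordonMultisetsExact k c (m + c) n = ∅ := by
      refine Set.eq_empty_of_forall_notMem fun s hs => h ?_
      obtain ⟨⟨h0, hn, hm, -⟩, -⟩ := hs
      rw [← hn, ← hm]
      exact card_le_sum_of_zero_notMem h0
    rw [this, Set.ncard_empty, Nat.cast_zero]

theorem gordonGenFun_zero_left (k m : ℕ) : gordonGenFun k 0 m = X ^ m * gordonGenFun k k m := by
  have h := mk_ncard_gordonMultisetsExact (Nat.zero_le k) m
  simp only [gordonMultisetsExact_zero, add_zero, Nat.sub_zero] at h
  exact h

theorem gordonGenFun_succ {k c : ℕ} (hc : c + 1 ≤ k) (m : ℕ) :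
    gordonGenFun k (c + 1) (m + (c + 1)) = gordonGenFun k c (m + (c + 1)) +
      X ^ (m + (c + 1)) * gordonGenFun k (k - (c + 1)) m := by
  rw [← mk_ncard_gordonMultisetsExact hc]
  ext n
  simp [gordonGenFun, ncard_gordonMultisets_succ]

theorem gordonGenFun_succ_of_lt (k : ℕ) {c m : ℕ} (hm : m < c + 1) :
    gordonGenFun k (c + 1) m = gordonGenFun k c m := by
  have h : ∀ n, gordonMultisetsExact k (c + 1) m n = ∅ := fun n =>
    Set.eq_empty_of_forall_notMem fun s ⟨⟨_, _, h, _⟩, h'⟩ => by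
      have := Multiset.count_le_card 1 s
      omega
  ext n
  simp [gordonGenFun, ncard_gordonMultisets_succ, h]

theorem gordonGenFun_zero_right (k c : ℕ) : gordonGenFun k c 0 = 1 := by
  ext n
  rw [gordonGenFun, coeff_mk, coeff_one]
  split_ifs with h
  · have : gordonMultisets k c 0 n = {0} := by
      ext s
      simp only [gordonMultisets, Set.mem_ofPred_eq, Set.mem_singleton_iff, Multiset.card_eq_zero]
      exact ⟨fun h => h.2.2.1, fun hs => by simp [hs, h]⟩
    simp [this]
  · have : gordonMultisets k c 0 n = ∅ := by
      refine Set.eq_empty_of_forall_notMem fun s hs => h ?_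
      obtain ⟨-, hn, hm, -⟩ := hs
      rw [← hn, Multiset.card_eq_zero.1 hm, Multiset.sum_zero]
    simp [this]

theorem proposition3p6 (r i m : ℕ) (hr : 2 ≤ r) (hi : 1 ≤ i) (hir : i ≤ r) :
    PowerSeries.mk (fun n : ℕ => (gordonCount r i m n : ℚ)) =
      ∑ d ∈ durfeeSides r (m + r - i), gordonSummand r i d := by
  obtain ⟨k, rfl⟩ := Nat.exists_eq_add_of_le' (by omega : 1 ≤ r)
  obtain ⟨c, rfl⟩ := Nat.exists_eq_add_of_le' hi
  have hc : c ≤ k := by omega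
  rw [sum_gordonSummand (by omega) hc]
  simp only [gordonCount_eq_ncard]
  exact eq_of_gordon_recurrence (F := gordonGenFun k) (G := gordonSeries k)
    (fun c _ => gordonGenFun_zero_right k c) (fun c _ => gordonSeries_zero_right k c)
    (gordonGenFun_zero_left k) (gordonSeries_zero_left k)
    (fun c m _ hm => gordonGenFun_succ_of_lt k hm) (fun c m hc hm => gordonSeries_succ_of_lt hc hm)
    (fun c m hc => gordonGenFun_succ hc m) (fun c m hc => gordonSeries_succ hc) hc m
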